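/- For each integer $n\ge 1$ let $P_n(z)=\frac{1}{\sqrt n}\sum_{j=0}^{n-1}e^{\pi i j^2/n}z^j$ be the $n$-th Gauss–Fresnel (Newman–Gauss) polynomial, and for a nonzero polynomial $P\in\mathbb{C}[z]$ let $$M(P)=\exp\Big(\frac1{2\pi}\int_0^{2\pi}\log|P(e^{i\theta})|\,d\theta\Big)$$ be its Mahler measure. Then there is a strictly increasing sequence of positive integers $(n_k)_{k\ge0}$ such that $$M(P_{n_k})\longrightarrow 1\qquad(k\to\infty).$$ Consequently (Beller–Newman, in asymptotic form), there are polynomials $q_k\in\mathbb{C}[z]$ with strictly increasing degrees $d_k$, all of whose coefficients of index $0,\dots,d_k$ have modulus $1$, such that $M(q_k)/\sqrt{d_k+1}\to1$ as $k\to\infty$. -/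

import Mathlib

/-- The `n`-th Gauss–Fresnel (Newman–Gauss) polynomial
`P_n(z) = n^{-1/2} ∑_{j=0}^{n-1} e^{π i j² / n} z^j`, for `n ≥ 1`. -/
noncomputable def gaussFresnel (n : ℕ) : Polynomial ℂ :=
  Polynomial.C ((Real.sqrt n : ℂ)⁻¹) *
    ∑ j ∈ Finset.range n,
      Polynomial.C (Complex.exp (Real.pi * Complex.I * (j : ℂ) ^ 2 / (n : ℂ))) * Polynomial.X ^ j

/-! Only even `n` are used. The upper bound `M(P_n) ≤ 1` is `M ≤ ‖·‖₂` together with `‖P_n‖₂ = 1`.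
The lower bound compares `P_n` with its values at the `n`-th roots of unity, where Gauss-sum duality
gives `|P_n| = 1` exactly.

On the circle `|P_n|² = 1 + 2 Re A`, where `A` has the autocorrelations of the coefficients as its
own coefficients. Each autocorrelation is an explicit geometric sum, and Parseval gives that `A'`
has mean square `O(n^{3/2} log n)`. Cut the circle into `n` arcs at the grid. If `|P_n|² ≥ 1 - η`
throughout an arc, then `log |P_n| ≥ -η` there. Otherwise `Re A` moves by at least `η/2` across an
arc of length `2π/n`, so by Cauchy–Schwarz that arc carries energy of `A'` of order `η² n`; there
are only `O(√n log n / η²)` such arcs.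

A bad arc cannot cost much. At radius `1 - τ/n`, with `τ` of order `1 / log n`, just inside its grid
point, duality still gives `|P_n| ≥ 1/2`. Poisson–Jensen based there, with kernel of order `τ n` on
the arc, bounds the loss by `O(log² n / n)`. The total loss is `η + O(log³ n / (η² √n))`; let `n →
∞`, then `η → 0`. -/

open Polynomial

/-! ### Powers of `e^{πi/n}` and their distance from 1 -/

/-- The primitive `2n`-th root of unity `e^{πi/n}`. -/
noncomputable def chirpRoot (n : ℕ) : ℂ := Complex.exp (Real.pi * Complex.I / n)

lemma chirpRoot_ne_zero (n : ℕ) : chirpRoot n ≠ 0 := Complex.exp_ne_zero _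

lemma chirpRoot_zpow (n : ℕ) (a : ℤ) :
    chirpRoot n ^ a = Complex.exp (Complex.I * ((Real.pi * a / n : ℝ) : ℂ)) := by
  rw [chirpRoot, ← Complex.exp_int_mul]
  congr 1
  push_cast
  ring

lemma norm_chirpRoot (n : ℕ) : ‖chirpRoot n‖ = 1 := by
  have h := chirpRoot_zpow n 1
  rw [zpow_one] at h
  rw [h, mul_comm, Complex.norm_exp_ofReal_mul_I]

lemma norm_chirpRoot_zpow (n : ℕ) (a : ℤ) : ‖chirpRoot n ^ a‖ = 1 := by
  rw [norm_zpow, norm_chirpRoot, one_zpow]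

lemma conj_chirpRoot_zpow (n : ℕ) (a : ℤ) :
    (starRingEnd ℂ) (chirpRoot n ^ a) = chirpRoot n ^ (-a) := by
  rw [zpow_neg, Complex.inv_eq_conj (norm_chirpRoot_zpow n a)]

lemma chirpRoot_pow_two_mul {n : ℕ} (hn : 0 < n) : chirpRoot n ^ (2 * (n : ℤ)) = 1 := by
  rw [chirpRoot_zpow, Complex.exp_eq_one_iff]
  refine ⟨1, ?_⟩
  have : (n : ℂ) ≠ 0 := by exact_mod_cast hn.ne'
  push_cast
  field_simp

lemma chirpRoot_zpow_two_mul_mul {n : ℕ} (hn : 0 < n) (a : ℤ) :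
    chirpRoot n ^ (2 * (n : ℤ) * a) = 1 := by
  rw [zpow_mul, chirpRoot_pow_two_mul hn, one_zpow]

lemma chirpRoot_zpow_add_two_mul {n : ℕ} (hn : 0 < n) (a b : ℤ) :
    chirpRoot n ^ (a + 2 * (n : ℤ) * b) = chirpRoot n ^ a := by
  rw [zpow_add₀ (chirpRoot_ne_zero n), chirpRoot_zpow_two_mul_mul hn, mul_one]

lemma norm_chirpRoot_zpow_sub_one (n : ℕ) (a : ℤ) :
    ‖chirpRoot n ^ a - 1‖ = 2 * |Real.sin (Real.pi * a / n / 2)| := by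
  rw [chirpRoot_zpow, Complex.norm_exp_I_mul_ofReal_sub_one]
  simp

lemma norm_chirpRoot_zpow_sub_one_le (n a : ℕ) :
    ‖chirpRoot n ^ (a : ℤ) - 1‖ ≤ Real.pi * a / n := by
  rw [norm_chirpRoot_zpow_sub_one]
  have h : |Real.sin (Real.pi * (a : ℤ) / n / 2)| ≤ |Real.pi * (a : ℤ) / n / 2| :=
    Real.abs_sin_le_abs
  rw [abs_of_nonneg (by simp; positivity : (0 : ℝ) ≤ Real.pi * (a : ℤ) / n / 2)] at h
  push_cast at h ⊢
  linarith

/-- Distance from `l` to the nearest of the endpoints `0`, `n`. -/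
def endDist (n l : ℕ) : ℕ := min l (n - l)

lemma endDist_pos {n l : ℕ} (h0 : 0 < l) (hl : l < n) : 0 < endDist n l := by
  unfold endDist; omega

/-- Jordan's inequality `sin x ≥ 2x/π` on `[0, π/2]`, after reflecting `l` to `n - l` in the upper
half. -/
lemma endDist_div_le_norm {n l : ℕ} (hl : l < n) :
    4 * (endDist n l : ℝ) / n ≤ ‖chirpRoot n ^ (2 * (l : ℤ)) - 1‖ := by
  have hn : (0 : ℝ) < n := by exact_mod_cast (Nat.zero_le l).trans_lt hl
  have key : ∀ m : ℕ, 2 * m ≤ n → 4 * (m : ℝ) / n ≤ 2 * Real.sin (Real.pi * m / n) := by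
    intro m hm
    have hm' : 2 * (m : ℝ) ≤ n := by exact_mod_cast hm
    have h := Real.mul_le_sin (x := Real.pi * m / n) (by positivity) (by
      rw [div_le_div_iff₀ hn two_pos]
      nlinarith [Real.pi_pos])
    have e : 2 / Real.pi * (Real.pi * m / n) = 2 * m / n := by
      have := Real.pi_ne_zero
      field_simp
    rw [e] at h
    calc 4 * (m : ℝ) / n = 2 * (2 * m / n) := by ring
      _ ≤ _ := by linarith
  rw [norm_chirpRoot_zpow_sub_one]
  have e : Real.pi * ((2 * (l : ℤ) : ℤ) : ℝ) / n / 2 = Real.pi * l / n := by push_cast; ring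
  rw [e]
  refine le_trans ?_ (mul_le_mul_of_nonneg_left (le_abs_self _) two_pos.le)
  rcases le_total (2 * l) n with h | h
  · have : endDist n l = l := by unfold endDist; omega
    rw [this]
    exact key l h
  · have : endDist n l = n - l := by unfold endDist; omega
    rw [this]
    have h2 := key (n - l) (by omega)
    have e2 : Real.pi * ((n - l : ℕ) : ℝ) / n = Real.pi - Real.pi * l / n := by
      rw [Nat.cast_sub hl.le]
      field_simp
    rwa [e2, Real.sin_pi_sub] at h2

lemma sum_inv_endDist_le (n : ℕ) :
    ∑ l ∈ Finset.Ico 1 n, (endDist n l : ℝ)⁻¹ ≤ 2 * (1 + Real.log n) := by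
  have hH : ∑ l ∈ Finset.Ico 1 n, (l : ℝ)⁻¹ ≤ 1 + Real.log n := by
    have h := harmonic_le_one_add_log n
    rw [harmonic_eq_sum_Icc] at h
    push_cast at h
    refine le_trans (Finset.sum_le_sum_of_subset_of_nonneg ?_ ?_) h
    · intro x; simp; omega
    · intros; positivity
  have hR : ∑ l ∈ Finset.Ico 1 n, ((n - l : ℕ) : ℝ)⁻¹ = ∑ l ∈ Finset.Ico 1 n, (l : ℝ)⁻¹ := by
    have h := Finset.sum_Ico_reflect (fun l : ℕ => (l : ℝ)⁻¹) 1 (m := n) (n := n) (by omega)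
    rw [h]
    congr 1
    ext x; simp
  calc ∑ l ∈ Finset.Ico 1 n, (endDist n l : ℝ)⁻¹
      ≤ ∑ l ∈ Finset.Ico 1 n, ((l : ℝ)⁻¹ + ((n - l : ℕ) : ℝ)⁻¹) := by
        refine Finset.sum_le_sum fun l _ => ?_
        have h1 : (0 : ℝ) ≤ (l : ℝ)⁻¹ := by positivity
        have h2 : (0 : ℝ) ≤ ((n - l : ℕ) : ℝ)⁻¹ := by positivity
        rcases min_choice l (n - l) with h | h <;> rw [endDist, h] <;> linarith
    _ ≤ 2 * (1 + Real.log n) := by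
        rw [Finset.sum_add_distrib, hR]
        linarith

/-! ### Gauss-sum duality and values at and near the grid -/

lemma sum_range_add_of_periodic {f : ℤ → ℂ} {n : ℕ} (hf : ∀ x, f (x + n) = f x) (k : ℕ) :
    ∑ i ∈ Finset.range n, f (i + k) = ∑ i ∈ Finset.range n, f i := by
  induction k with
  | zero => simp
  | succ k ih =>
    rw [← ih]
    have h1 := Finset.sum_range_succ (fun i : ℕ => f (i + k)) n
    have h2 := Finset.sum_range_succ' (fun i : ℕ => f (i + k)) n
    have h3 : f ((n : ℤ) + k) = f (((0 : ℕ) : ℤ) + k) := by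
      rw [add_comm, hf]; simp
    rw [h1, h3] at h2
    have h4 := add_right_cancel h2
    rw [h4]
    refine Finset.sum_congr rfl fun i _ => ?_
    congr 1
    push_cast
    ring

/-- The conjugate quadratic Gauss sum `∑_{m<n} e^{-πi m²/n}`. -/
noncomputable def chirpSum (n : ℕ) : ℂ := ∑ m ∈ Finset.range n, chirpRoot n ^ (-(m : ℤ) ^ 2)

/-- Parity enters here: `(x + n)² - x² = 2nx + n²`, and `n²` is a multiple of `2n` because `n` is
even. -/
lemma sum_chirpRoot_shift {n : ℕ} (hn : 0 < n) (he : Even n) (k : ℕ) :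
    ∑ m ∈ Finset.range n, chirpRoot n ^ (-((m : ℤ) + k) ^ 2) = chirpSum n := by
  obtain ⟨N, hN⟩ := he
  refine sum_range_add_of_periodic (f := fun x => chirpRoot n ^ (-x ^ 2)) (fun x => ?_) k
  have e : -(x + (n : ℤ)) ^ 2 = -x ^ 2 + 2 * (n : ℤ) * (-x - N) := by
    have : (n : ℤ) = N + N := by exact_mod_cast hN
    rw [this]; ring
  simp only [e]
  exact chirpRoot_zpow_add_two_mul hn _ _

/-- Complete the square in `m`; the linear term becomes a shift of the Gauss sum by `j + k`. -/
lemma sum_chirpRoot_dual {n : ℕ} (hn : 0 < n) (he : Even n) (j k : ℕ) :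
    ∑ m ∈ Finset.range n, chirpRoot n ^ (-((m : ℤ) + k) ^ 2) * chirpRoot n ^ (-2 * (j : ℤ) * m) =
      chirpRoot n ^ ((j : ℤ) ^ 2 + 2 * j * k) * chirpSum n := by
  rw [← sum_chirpRoot_shift hn he (j + k), Finset.mul_sum]
  refine Finset.sum_congr rfl fun m _ => ?_
  rw [← zpow_add₀ (chirpRoot_ne_zero n), ← zpow_add₀ (chirpRoot_ne_zero n)]
  congr 1
  push_cast
  ring

/-- With `w` the root of unity, `w^n = 1` makes the numerator `1 - r^n`, and `|w - 1| ≤ |rw - 1| +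
(1 - r) ≤ 2|rw - 1|` keeps the denominator away from 0. At `r = 1` this is orthogonality; for `r`
near 1 it is an approximate form of it. -/
lemma geom_sum_chirpRoot {n l : ℕ} (h0 : 0 < l) (hl : l < n) (s : ℤ) (hs : s = 1 ∨ s = -1)
    (r : ℝ) (hr0 : 0 ≤ r) (hr1 : r ≤ 1) :
    ‖∑ j ∈ Finset.range n, ((r : ℂ) * chirpRoot n ^ (s * (2 * (l : ℤ)))) ^ j‖ ≤
      (1 - r ^ n) * n / (2 * endDist n l) := by
  have hn : 0 < n := h0.trans hl
  set w := chirpRoot n ^ (s * (2 * (l : ℤ))) with hw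
  have hn' : (0 : ℝ) < n := by exact_mod_cast hn
  have hd : (0 : ℝ) < endDist n l := by exact_mod_cast endDist_pos h0 hl
  have hw1 : ‖w‖ = 1 := norm_chirpRoot_zpow _ _
  have hsep : 4 * (endDist n l : ℝ) / n ≤ ‖w - 1‖ := by
    have h := endDist_div_le_norm hl
    rcases hs with rfl | rfl
    · simpa [hw] using h
    · have e : w = (starRingEnd ℂ) (chirpRoot n ^ (2 * (l : ℤ))) := by
        rw [conj_chirpRoot_zpow, hw]; congr 1; ring
      rw [e, ← map_one (starRingEnd ℂ), ← map_sub, Complex.norm_conj]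
      exact h
  have hwn : w ^ n = 1 := by
    rw [hw, ← zpow_natCast, ← zpow_mul]
    rw [show s * (2 * (l : ℤ)) * n = 2 * (n : ℤ) * (s * l) by ring]
    exact chirpRoot_zpow_two_mul_mul hn _
  have hsep2 : 2 * (endDist n l : ℝ) / n ≤ ‖(r : ℂ) * w - 1‖ := by
    have h1 : ‖w - 1‖ ≤ ‖(r : ℂ) * w - 1‖ + (1 - r) := by
      have e : w - 1 = ((r : ℂ) * w - 1) + ((1 - r : ℝ) : ℂ) * w := by push_cast; ring
      calc ‖w - 1‖ ≤ ‖(r : ℂ) * w - 1‖ + ‖((1 - r : ℝ) : ℂ) * w‖ := by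
            conv_lhs => rw [e]
            exact norm_add_le _ _
        _ = _ := by rw [norm_mul, hw1, Complex.norm_real, Real.norm_of_nonneg (by linarith), mul_one]
    have h2 : 1 - r ≤ ‖(r : ℂ) * w - 1‖ := by
      have := norm_sub_norm_le (1 : ℂ) ((r : ℂ) * w)
      rw [norm_sub_rev, norm_one, norm_mul, hw1, Complex.norm_real, Real.norm_of_nonneg hr0,
        mul_one] at this
      exact this
    have : 4 * (endDist n l : ℝ) / n = 2 * (2 * endDist n l / n) := by ring
    linarith
  have hpos : 0 < ‖(r : ℂ) * w - 1‖ := lt_of_lt_of_le (by positivity) hsep2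
  have hne : (r : ℂ) * w ≠ 1 := fun h => by simp [h] at hpos
  rw [geom_sum_eq hne, norm_div, mul_pow, hwn, mul_one]
  have e : ‖(r : ℂ) ^ n - 1‖ = 1 - r ^ n := by
    rw [norm_sub_rev, ← Complex.ofReal_pow, ← Complex.ofReal_one, ← Complex.ofReal_sub,
      Complex.norm_real, Real.norm_of_nonneg]
    linarith [pow_le_one₀ hr0 hr1 (n := n)]
  rw [e]
  have hnum : 0 ≤ 1 - r ^ n := by linarith [pow_le_one₀ hr0 hr1 (n := n)]
  calc (1 - r ^ n) / ‖(r : ℂ) * w - 1‖ ≤ (1 - r ^ n) / (2 * (endDist n l : ℝ) / n) := by gcongr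
    _ = _ := by field_simp

lemma eval_gaussFresnel (n : ℕ) (z : ℂ) : (gaussFresnel n).eval z =
    ((Real.sqrt n : ℂ)⁻¹) * ∑ j ∈ Finset.range n, chirpRoot n ^ ((j : ℤ) ^ 2) * z ^ j := by
  simp only [gaussFresnel, eval_mul, eval_C, eval_finsetSum, eval_pow, eval_X]
  congr 1
  refine Finset.sum_congr rfl fun j _ => ?_
  rw [chirpRoot, ← Complex.exp_int_mul]
  congr 2
  push_cast
  ring

/-- Duality trades the chirp coefficients for a superposition of plain geometric sums in `r`. Near a
grid point (`r` close to 1) the term `m = 0` dominates. -/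
lemma chirpSum_mul_eval {n : ℕ} (hn : 0 < n) (he : Even n) (k : ℕ) (r : ℂ) :
    chirpSum n * ∑ j ∈ Finset.range n,
        chirpRoot n ^ ((j : ℤ) ^ 2) * (r * chirpRoot n ^ (2 * (k : ℤ))) ^ j =
      ∑ m ∈ Finset.range n, chirpRoot n ^ (-((m : ℤ) + k) ^ 2) *
        ∑ j ∈ Finset.range n, (r * chirpRoot n ^ (-1 * (2 * (m : ℤ)))) ^ j := by
  have h0 := chirpRoot_ne_zero n
  simp only [Finset.mul_sum]
  rw [Finset.sum_comm (s := Finset.range n) (t := Finset.range n)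
    (f := fun m j => chirpRoot n ^ (-((m : ℤ) + k) ^ 2) *
      (r * chirpRoot n ^ (-1 * (2 * (m : ℤ)))) ^ j)]
  refine Finset.sum_congr rfl fun j _ => ?_
  have h := sum_chirpRoot_dual hn he j k
  calc _ = r ^ j * (chirpRoot n ^ ((j : ℤ) ^ 2 + 2 * j * k) * chirpSum n) := by
        rw [mul_pow, zpow_add₀ h0, ← zpow_natCast (chirpRoot n ^ (2 * (k : ℤ))), ← zpow_mul,
          show 2 * (j : ℤ) * k = 2 * k * j by ring]
        ring
    _ = _ := by
        rw [← h, Finset.mul_sum]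
        refine Finset.sum_congr rfl fun m _ => ?_
        rw [mul_pow, ← zpow_natCast (chirpRoot n ^ (-1 * (2 * (m : ℤ)))), ← zpow_mul,
          show -2 * (j : ℤ) * m = -1 * (2 * m) * j by ring]
        ring

lemma geom_sum_chirpRoot_eq_zero {n m : ℕ} (h0 : 0 < m) (hm : m < n) :
    ∑ j ∈ Finset.range n, (chirpRoot n ^ (-1 * (2 * (m : ℤ)))) ^ j = 0 := by
  have h := geom_sum_chirpRoot h0 hm (-1) (Or.inr rfl) 1 zero_le_one le_rfl
  rw [one_pow, sub_self, zero_mul, zero_div, norm_le_zero_iff] at h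
  simpa using h

lemma chirpSum_mul_eval_one {n : ℕ} (hn : 0 < n) (he : Even n) (k : ℕ) :
    chirpSum n * ∑ j ∈ Finset.range n,
        chirpRoot n ^ ((j : ℤ) ^ 2) * (chirpRoot n ^ (2 * (k : ℤ))) ^ j =
      chirpRoot n ^ (-(k : ℤ) ^ 2) * n := by
  have h := chirpSum_mul_eval hn he k 1
  simp only [one_mul] at h
  rw [h, Finset.sum_eq_single_of_mem 0 (by simpa using hn)]
  · simp
  · intro m hm hm0
    rw [geom_sum_chirpRoot_eq_zero (Nat.pos_of_ne_zero hm0) (Finset.mem_range.1 hm), mul_zero]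

/-- At the grid point 1 the polynomial sum is the conjugate of the Gauss sum, so duality reads `|S|²
= n`. -/
lemma norm_chirpSum {n : ℕ} (hn : 0 < n) (he : Even n) : ‖chirpSum n‖ = Real.sqrt n := by
  have h := chirpSum_mul_eval_one hn he 0
  have e1 : ∑ j ∈ Finset.range n,
      chirpRoot n ^ ((j : ℤ) ^ 2) * (chirpRoot n ^ (2 * ((0 : ℕ) : ℤ))) ^ j =
      (starRingEnd ℂ) (chirpSum n) := by
    rw [chirpSum, map_sum]
    refine Finset.sum_congr rfl fun j _ => ?_
    rw [conj_chirpRoot_zpow]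
    simp
  rw [e1, Complex.mul_conj] at h
  have h2 : Complex.normSq (chirpSum n) = n := by
    have : (Complex.normSq (chirpSum n) : ℂ) = n := by simpa using h
    exact_mod_cast this
  rw [Complex.normSq_eq_norm_sq] at h2
  rw [← h2, Real.sqrt_sq (norm_nonneg _)]

lemma norm_eval_gaussFresnel_grid {n : ℕ} (hn : 0 < n) (he : Even n) (k : ℕ) :
    ‖(gaussFresnel n).eval (chirpRoot n ^ (2 * (k : ℤ)))‖ = 1 := by
  have hs : (0 : ℝ) < Real.sqrt n := Real.sqrt_pos.2 (by exact_mod_cast hn)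
  have h2 := congrArg norm (chirpSum_mul_eval_one hn he k)
  rw [norm_mul, norm_mul, norm_chirpSum hn he, norm_chirpRoot_zpow, one_mul,
    Complex.norm_natCast] at h2
  rw [eval_gaussFresnel, norm_mul]
  simp only [norm_inv, Complex.norm_real, Real.norm_of_nonneg hs.le]
  rw [inv_mul_eq_one₀ hs.ne']
  have h3 : Real.sqrt n * Real.sqrt n = n := Real.mul_self_sqrt (Nat.cast_nonneg n)
  exact mul_left_cancel₀ hs.ne' (h3.trans h2.symm)

/-- In the dual expansion the term `m = 0` is at least `n(1 - τ)`, and the others total at most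
`nτ(1 + log n)` by the harmonic sum. The hypothesis on `τ` leaves at least `n/2`. -/
lemma half_le_norm_eval_gaussFresnel {n : ℕ} (hn : 0 < n) (he : Even n) (k : ℕ) {τ : ℝ}
    (hτ0 : 0 ≤ τ) (hτ : τ * (2 + Real.log n) ≤ 1 / 2) (hτ1 : τ ≤ 1) :
    1 / 2 ≤ ‖(gaussFresnel n).eval (((1 - τ / n : ℝ) : ℂ) * chirpRoot n ^ (2 * (k : ℤ)))‖ := by
  have hn' : (1 : ℝ) ≤ n := by exact_mod_cast hn
  have hs : (0 : ℝ) < Real.sqrt n := Real.sqrt_pos.2 (by exact_mod_cast hn)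
  have h3 : Real.sqrt n * Real.sqrt n = n := Real.mul_self_sqrt (Nat.cast_nonneg n)
  set r : ℝ := 1 - τ / n with hr
  have hτn : τ / n ≤ 1 := by rw [div_le_one (by linarith)]; linarith
  have hτn0 : 0 ≤ τ / n := by positivity
  have hr0 : 0 ≤ r := by linarith
  have hr1 : r ≤ 1 := by linarith
  -- Bernoulli's inequality.
  have hrn : 1 - τ ≤ r ^ n := by
    have := one_add_mul_le_pow (a := -(τ / n)) (by linarith) n
    rw [hr, sub_eq_add_neg]
    refine le_trans (le_of_eq ?_) this
    field_simp
  have h := chirpSum_mul_eval hn he k (r : ℂ)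
  have hsplit := Finset.sum_eq_sum_Ico_succ_bot hn
    (fun m => chirpRoot n ^ (-((m : ℤ) + k) ^ 2) *
        ∑ j ∈ Finset.range n, ((r : ℂ) * chirpRoot n ^ (-1 * (2 * (m : ℤ)))) ^ j)
  rw [← Finset.range_eq_Ico] at hsplit
  rw [hsplit] at h
  set F := ∑ j ∈ Finset.range n,
    chirpRoot n ^ ((j : ℤ) ^ 2) * ((r : ℂ) * chirpRoot n ^ (2 * (k : ℤ))) ^ j with hF
  set M := chirpRoot n ^ (-(((0 : ℕ) : ℤ) + (k : ℤ)) ^ 2) *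
    ∑ j ∈ Finset.range n, ((r : ℂ) * chirpRoot n ^ (-1 * (2 * ((0 : ℕ) : ℤ)))) ^ j with hM
  have hMn : n * (1 - τ) ≤ ‖M‖ := by
    have e : ∑ j ∈ Finset.range n, ((r : ℂ) * chirpRoot n ^ (-1 * (2 * ((0 : ℕ) : ℤ)))) ^ j =
        ((∑ j ∈ Finset.range n, r ^ j : ℝ) : ℂ) := by
      push_cast
      refine Finset.sum_congr rfl fun j _ => by simp
    rw [hM, e, norm_mul, norm_chirpRoot_zpow, one_mul, Complex.norm_real]
    refine le_trans ?_ (le_abs_self _)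
    calc n * (1 - τ) ≤ n * r ^ n := by gcongr
      _ = ∑ j ∈ Finset.range n, r ^ n := by simp
      _ ≤ _ := Finset.sum_le_sum fun j hj =>
        pow_le_pow_of_le_one hr0 hr1 (Finset.mem_range.1 hj).le
  have hrest : ‖∑ m ∈ Finset.Ico (0 + 1) n, chirpRoot n ^ (-((m : ℤ) + k) ^ 2) *
      ∑ j ∈ Finset.range n, ((r : ℂ) * chirpRoot n ^ (-1 * (2 * (m : ℤ)))) ^ j‖ ≤
      n * (τ * (1 + Real.log n)) := by
    calc _ ≤ ∑ m ∈ Finset.Ico (0 + 1) n, τ * n / 2 * (endDist n m : ℝ)⁻¹ := by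
          refine norm_sum_le_of_le _ fun m hm => ?_
          rw [Finset.mem_Ico] at hm
          rw [norm_mul, norm_chirpRoot_zpow, one_mul]
          refine (geom_sum_chirpRoot (by omega) hm.2 (-1) (Or.inr rfl) r hr0 hr1).trans ?_
          rw [show τ * n / 2 * (endDist n m : ℝ)⁻¹ = τ * n / (2 * endDist n m) by
            rw [div_mul_eq_div_div]; rfl]
          gcongr
          linarith
      _ ≤ τ * n / 2 * (2 * (1 + Real.log n)) := by
          rw [← Finset.mul_sum]
          gcongr
          exact sum_inv_endDist_le n
      _ = _ := by ring
  have hlow : n * (1 / 2) ≤ ‖chirpSum n * F‖ := by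
    rw [h]
    refine le_trans ?_ (norm_sub_le_norm_add _ _)
    have : n * (1 / 2 : ℝ) ≤ n * (1 - τ * (2 + Real.log n)) := by gcongr; linarith
    nlinarith [hMn, hrest]
  rw [norm_mul, norm_chirpSum hn he] at hlow
  rw [eval_gaussFresnel, ← hF, norm_mul]
  simp only [norm_inv, Complex.norm_real, Real.norm_of_nonneg hs.le]
  rw [le_inv_mul_iff₀ hs]
  refine le_of_mul_le_mul_left ?_ hs
  calc Real.sqrt n * (Real.sqrt n * (1 / 2)) = n * (1 / 2) := by rw [← mul_assoc, h3]
    _ ≤ _ := hlow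

/-! ### Autocorrelations and the energy of the derivative -/

/-- The aperiodic autocorrelation of the first `n` terms of `a`. -/
noncomputable def autocorrelation (a : ℕ → ℂ) (n m : ℕ) : ℂ :=
  ∑ l ∈ Finset.range (n - m), a (l + m) * (starRingEnd ℂ) (a l)

/-- The added terms are the pairs involving the new top index `n`: exactly the cross term in `|S +
a_n z^n|²`, which drives the induction below. -/
lemma sum_autocorrelation_succ (a : ℕ → ℂ) (n : ℕ) {z : ℂ} (hz : ‖z‖ = 1) :
    ∑ m ∈ Finset.Ico 1 (n + 1), autocorrelation a (n + 1) m * z ^ m =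
      ∑ m ∈ Finset.Ico 1 n, autocorrelation a n m * z ^ m +
        a n * z ^ n * (starRingEnd ℂ) (∑ j ∈ Finset.range n, a j * z ^ j) := by
  have h1 : ∀ m ∈ Finset.Ico 1 (n + 1), autocorrelation a (n + 1) m * z ^ m =
      autocorrelation a n m * z ^ m + a n * (starRingEnd ℂ) (a (n - m)) * z ^ m := by
    intro m hm
    rw [Finset.mem_Ico] at hm
    rw [autocorrelation, autocorrelation, show n + 1 - m = (n - m) + 1 by omega,
      Finset.sum_range_succ, show n - m + m = n by omega, add_mul]
  rw [Finset.sum_congr rfl h1, Finset.sum_add_distrib]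
  congr 1
  · rcases Nat.eq_zero_or_pos n with rfl | hn
    · simp
    · rw [Finset.sum_Ico_succ_top (by omega)]
      simp [autocorrelation]
  · rw [map_sum, Finset.mul_sum, Finset.sum_Ico_eq_sum_range, Nat.add_sub_cancel,
      ← Finset.sum_range_reflect]
    refine Finset.sum_congr rfl fun j hj => ?_
    rw [Finset.mem_range] at hj
    rw [show 1 + (n - 1 - j) = n - j by omega, show n - (n - j) = j by omega, map_mul, map_pow]
    have h2 : z ^ n = z ^ (n - j) * z ^ j := by rw [← pow_add]; congr 1; omega
    have h3 : z ^ j * (starRingEnd ℂ) z ^ j = 1 := by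
      rw [← mul_pow, Complex.mul_conj, Complex.normSq_eq_norm_sq, hz]; simp
    rw [h2]
    linear_combination (-(a n * (starRingEnd ℂ) (a j) * z ^ (n - j))) * h3

lemma norm_sq_sum_eq_autocorrelation (a : ℕ → ℂ) (n : ℕ) {z : ℂ} (hz : ‖z‖ = 1) :
    ‖∑ j ∈ Finset.range n, a j * z ^ j‖ ^ 2 = ∑ j ∈ Finset.range n, ‖a j‖ ^ 2 +
      2 * (∑ m ∈ Finset.Ico 1 n, autocorrelation a n m * z ^ m).re := by
  induction n with
  | zero => simp
  | succ n ih =>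
    rw [sum_autocorrelation_succ a n hz, Finset.sum_range_succ, Finset.sum_range_succ,
      ← Complex.normSq_eq_norm_sq, Complex.normSq_add, Complex.normSq_eq_norm_sq, ih,
      Complex.normSq_eq_norm_sq, norm_mul, norm_pow, hz, one_pow, mul_one, Complex.add_re]
    have e : ((∑ j ∈ Finset.range n, a j * z ^ j) * (starRingEnd ℂ) (a n * z ^ n)).re =
        (a n * z ^ n * (starRingEnd ℂ) (∑ j ∈ Finset.range n, a j * z ^ j)).re := by
      rw [← Complex.conj_re, map_mul, Complex.conj_conj, mul_comm]
    rw [e]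
    ring

/-- The coefficients of the Gauss–Fresnel polynomial. -/
noncomputable def gaussCoeff (n j : ℕ) : ℂ :=
  (Real.sqrt n : ℂ)⁻¹ * chirpRoot n ^ ((j : ℤ) ^ 2)

lemma eval_gaussFresnel_eq_sum (n : ℕ) (z : ℂ) :
    (gaussFresnel n).eval z = ∑ j ∈ Finset.range n, gaussCoeff n j * z ^ j := by
  rw [eval_gaussFresnel, Finset.mul_sum]
  simp only [gaussCoeff, mul_assoc]

lemma norm_gaussCoeff (n j : ℕ) : ‖gaussCoeff n j‖ = (Real.sqrt n)⁻¹ := by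
  rw [gaussCoeff, norm_mul, norm_chirpRoot_zpow, mul_one, norm_inv, Complex.norm_real,
    Real.norm_of_nonneg (Real.sqrt_nonneg _)]

lemma sum_norm_sq_gaussCoeff {n : ℕ} (hn : 0 < n) :
    ∑ j ∈ Finset.range n, ‖gaussCoeff n j‖ ^ 2 = 1 := by
  have : (n : ℝ) ≠ 0 := by exact_mod_cast hn.ne'
  simp [norm_gaussCoeff, this]

/-- The quadratic phases cancel, leaving a geometric sum of ratio `e^{2πim/n}`. Its numerator has
exponent `2m(n - m) = 2d(n - d)`, which is `-2d²` modulo `2n`, where `d` is the distance to the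
nearer endpoint. -/
lemma norm_autocorrelation_gaussCoeff {n m : ℕ} (h0 : 0 < m) (hm : m < n) :
    ‖autocorrelation (gaussCoeff n) n m‖ ≤
      ‖chirpRoot n ^ ((2 * endDist n m ^ 2 : ℕ) : ℤ) - 1‖ / (4 * endDist n m) := by
  have hn : 0 < n := h0.trans hm
  have hn' : (0 : ℝ) < n := by exact_mod_cast hn
  have hd : (0 : ℝ) < endDist n m := by exact_mod_cast endDist_pos h0 hm
  have hz := chirpRoot_ne_zero n
  have hs : (Real.sqrt n : ℂ)⁻¹ * (starRingEnd ℂ) ((Real.sqrt n : ℂ)⁻¹) = (n : ℂ)⁻¹ := by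
    rw [map_inv₀, Complex.conj_ofReal, ← mul_inv, ← Complex.ofReal_mul,
      Real.mul_self_sqrt hn'.le, Complex.ofReal_natCast]
  have e : autocorrelation (gaussCoeff n) n m = (n : ℂ)⁻¹ * (chirpRoot n ^ ((m : ℤ) ^ 2) *
      ∑ l ∈ Finset.range (n - m), (chirpRoot n ^ (2 * (m : ℤ))) ^ l) := by
    rw [autocorrelation, Finset.mul_sum, Finset.mul_sum]
    refine Finset.sum_congr rfl fun l _ => ?_
    rw [gaussCoeff, gaussCoeff, map_mul, conj_chirpRoot_zpow, ← zpow_natCast, ← zpow_mul,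
      ← zpow_add₀ hz, ← hs,
      show (m : ℤ) ^ 2 + 2 * m * l = ((l + m : ℕ) : ℤ) ^ 2 + -(l : ℤ) ^ 2 by push_cast; ring,
      zpow_add₀ hz]
    ring
  have hsep := endDist_div_le_norm hm
  have hpos : 0 < ‖chirpRoot n ^ (2 * (m : ℤ)) - 1‖ := lt_of_lt_of_le (by positivity) hsep
  have hne : chirpRoot n ^ (2 * (m : ℤ)) ≠ 1 := fun h => by simp [h] at hpos
  have hprod : (m : ℤ) * (n - m : ℕ) = endDist n m * (n - endDist n m) := by
    unfold endDist
    rcases le_total m (n - m) with h | h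
    · rw [min_eq_left h, Nat.cast_sub hm.le]
    · rw [min_eq_right h, Nat.cast_sub hm.le]; ring
  have hnum : ‖(chirpRoot n ^ (2 * (m : ℤ))) ^ (n - m) - 1‖ =
      ‖chirpRoot n ^ ((2 * endDist n m ^ 2 : ℕ) : ℤ) - 1‖ := by
    rw [← zpow_natCast, ← zpow_mul, mul_assoc, hprod,
      show 2 * ((endDist n m : ℤ) * (n - endDist n m)) =
        -((2 * endDist n m ^ 2 : ℕ) : ℤ) + 2 * (n : ℤ) * endDist n m by push_cast; ring,
      chirpRoot_zpow_add_two_mul hn, ← conj_chirpRoot_zpow, ← map_one (starRingEnd ℂ), ← map_sub,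
      Complex.norm_conj, map_one]
  rw [e, geom_sum_eq hne, norm_mul, norm_mul, norm_chirpRoot_zpow, one_mul, norm_div, hnum,
    norm_inv, Complex.norm_natCast]
  calc _ ≤ (n : ℝ)⁻¹ * (‖chirpRoot n ^ ((2 * endDist n m ^ 2 : ℕ) : ℤ) - 1‖ /
        (4 * (endDist n m : ℝ) / n)) := by gcongr
    _ = _ := by field_simp

/-- Bounding the numerator by 2, or by its argument (with `π < 4`), gives the two bounds `2/d` and
`2d/n`. They cross at `d = √n`, and the smaller one squared is at most `4/(√n d)`. -/
lemma norm_sq_autocorrelation_gaussCoeff_le {n m : ℕ} (h0 : 0 < m) (hm : m < n) :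
    ‖autocorrelation (gaussCoeff n) n m‖ ^ 2 ≤ 4 / Real.sqrt n * (endDist n m : ℝ)⁻¹ := by
  have hn' : (0 : ℝ) < n := by exact_mod_cast h0.trans hm
  have hd : (0 : ℝ) < endDist n m := by exact_mod_cast endDist_pos h0 hm
  have hs : 0 < Real.sqrt n := Real.sqrt_pos.2 hn'
  have hss : Real.sqrt n * Real.sqrt n = n := Real.mul_self_sqrt hn'.le
  have h := norm_autocorrelation_gaussCoeff h0 hm
  have hpi := Real.pi_lt_four
  set x := ‖autocorrelation (gaussCoeff n) n m‖
  set d : ℝ := (endDist n m : ℝ)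
  set s := Real.sqrt n
  have hx : 0 ≤ x := norm_nonneg _
  have h1 : x ≤ 2 / d := by
    refine h.trans ?_
    have : ‖chirpRoot n ^ ((2 * endDist n m ^ 2 : ℕ) : ℤ) - 1‖ ≤ 2 := by
      refine (norm_sub_le _ _).trans ?_
      rw [norm_chirpRoot_zpow, norm_one]; norm_num
    rw [div_le_div_iff₀ (by positivity) hd]
    nlinarith
  have h2 : x ≤ 2 * d / n := by
    refine h.trans ?_
    have : ‖chirpRoot n ^ ((2 * endDist n m ^ 2 : ℕ) : ℤ) - 1‖ ≤ 8 * d ^ 2 / n := by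
      refine (norm_chirpRoot_zpow_sub_one_le n _).trans ?_
      rw [Nat.cast_mul, Nat.cast_pow, Nat.cast_ofNat]
      gcongr ?_ / _
      nlinarith [sq_nonneg d]
    calc _ ≤ 8 * d ^ 2 / n / (4 * d) := by gcongr
      _ = 2 * d / n := by field_simp; norm_num
  have target : 4 / s * d⁻¹ = 4 / (s * d) := by field_simp
  rw [target]
  rcases le_total d s with hds | hds
  · calc x ^ 2 ≤ (2 * d / n) ^ 2 := by gcongr
      _ = 4 * d ^ 2 / (s * s) ^ 2 := by rw [hss]; ring
      _ ≤ 4 / (s * d) := by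
        rw [div_le_div_iff₀ (by positivity) (by positivity)]
        have : d ^ 3 ≤ s ^ 3 := by gcongr
        nlinarith [mul_le_mul_of_nonneg_left this hs.le]
  · calc x ^ 2 ≤ (2 / d) ^ 2 := by gcongr
      _ = 4 / (d * d) := by ring
      _ ≤ 4 / (s * d) := by gcongr

/-- The analytic half of the Fourier expansion of `|P_n|²`. -/
noncomputable def autocorrelationPoly (n : ℕ) : ℂ[X] :=
  ∑ m ∈ Finset.Ico 1 n, C (autocorrelation (gaussCoeff n) n m) * X ^ m

lemma norm_sq_eval_gaussFresnel {n : ℕ} (hn : 0 < n) {z : ℂ} (hz : ‖z‖ = 1) :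
    ‖(gaussFresnel n).eval z‖ ^ 2 = 1 + 2 * ((autocorrelationPoly n).eval z).re := by
  rw [eval_gaussFresnel_eq_sum, norm_sq_sum_eq_autocorrelation _ _ hz, sum_norm_sq_gaussCoeff hn]
  simp [autocorrelationPoly, eval_finsetSum]

/-- Parseval, with each frequency bounded crudely by `n`; the factors `1/d` then sum to a logarithm.
-/
lemma circleAverage_norm_sq_derivative_autocorrelationPoly_le {n : ℕ} (hn : 0 < n) :
    Real.circleAverage (fun z => ‖(derivative (autocorrelationPoly n)).eval z‖ ^ 2) 0 1 ≤
      8 * n ^ 2 * (1 + Real.log n) / Real.sqrt n := by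
  rw [← sum_sq_norm_coeff_eq_circleAverage]
  have hs : 0 < Real.sqrt n := Real.sqrt_pos.2 (by exact_mod_cast hn)
  have hcoeff : ∀ i, (autocorrelationPoly n).coeff i =
      if i ∈ Finset.Ico 1 n then autocorrelation (gaussCoeff n) n i else 0 := by
    intro i
    simp only [autocorrelationPoly, finsetSum_coeff, coeff_C_mul, coeff_X_pow, mul_ite, mul_one,
      mul_zero, Finset.sum_ite_eq]
  have hsub : (derivative (autocorrelationPoly n)).support ⊆ Finset.range (n - 1) := by
    intro i hi
    rw [mem_support_iff, coeff_derivative, hcoeff] at hi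
    by_contra hcon
    rw [Finset.mem_range] at hcon
    rw [if_neg (by rw [Finset.mem_Ico]; omega), zero_mul] at hi
    exact hi rfl
  calc _ ≤ ∑ i ∈ Finset.range (n - 1), ‖(derivative (autocorrelationPoly n)).coeff i‖ ^ 2 :=
        Finset.sum_le_sum_of_subset_of_nonneg hsub fun _ _ _ => by positivity
    _ ≤ ∑ i ∈ Finset.range (n - 1), n ^ 2 * (4 / Real.sqrt n * (endDist n (1 + i) : ℝ)⁻¹) := by
        refine Finset.sum_le_sum fun i hi => ?_
        rw [Finset.mem_range] at hi
        rw [coeff_derivative, hcoeff, if_pos (by rw [Finset.mem_Ico]; omega), norm_mul, mul_pow,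
          mul_comm, add_comm i 1]
        have h1 := norm_sq_autocorrelation_gaussCoeff_le (n := n) (m := 1 + i) (by omega) (by omega)
        have h2 : ‖((i : ℂ) + 1)‖ ≤ n := by
          rw [← Nat.cast_succ, Complex.norm_natCast]
          exact_mod_cast (by omega : i.succ ≤ n)
        gcongr
    _ = n ^ 2 * (4 / Real.sqrt n) * ∑ m ∈ Finset.Ico 1 n, (endDist n m : ℝ)⁻¹ := by
        rw [Finset.sum_Ico_eq_sum_range, Finset.mul_sum]
        refine Finset.sum_congr rfl fun i _ => by ring
    _ ≤ n ^ 2 * (4 / Real.sqrt n) * (2 * (1 + Real.log n)) := by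
        gcongr
        exact sum_inv_endDist_le n
    _ = _ := by ring

/-! ### Poisson–Jensen inequality for polynomials -/

lemma circleAverage_poissonKernel_mul_log_norm_of_ne_zero {c : ℂ} (hc : ‖c‖ < 1) {f : ℂ → ℂ}
    (hf : Differentiable ℂ f) (h0 : ∀ z, ‖z‖ ≤ 1 → f z ≠ 0) :
    Real.circleAverage (fun z => poissonKernel 0 c z * Real.log ‖f z‖) 0 1 =
      Real.log ‖f c‖ := by
  refine InnerProductSpace.HarmonicOnNhd.circleAverage_poissonKernel_smul (f := fun z => Real.log ‖f z‖)
    (fun z hz => ?_) (by simpa using hc)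
  exact AnalyticAt.harmonicAt_log_norm (hf.analyticAt z) (h0 z (by simpa using hz))

/-- For `ρ` inside the disc, `1 - ρ̄z` has the same modulus as `z - ρ` on the circle, has no zero in
the closed disc, and is at least as large at `c`. For `ρ` on or outside the circle equality holds.
-/
lemma log_norm_sub_le_circleAverage_poissonKernel {c ρ : ℂ} (hc : ‖c‖ < 1) (hne : c ≠ ρ) :
    Real.log ‖c - ρ‖ ≤
      Real.circleAverage (fun z => poissonKernel 0 c z * Real.log ‖z - ρ‖) 0 1 := by
  rcases lt_trichotomy ‖ρ‖ 1 with h | h | h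
  · have hcirc : Set.EqOn (fun z => poissonKernel 0 c z * Real.log ‖z - ρ‖)
        (fun z => poissonKernel 0 c z * Real.log ‖1 - (starRingEnd ℂ) ρ * z‖)
        (Metric.sphere 0 |1|) := by
      intro z hz
      have hz1 : ‖z‖ = 1 := by simpa using hz
      have e : 1 - (starRingEnd ℂ) ρ * z = z * (starRingEnd ℂ) (z - ρ) := by
        rw [map_sub, mul_sub, Complex.mul_conj, Complex.normSq_eq_norm_sq, hz1]
        push_cast
        ring
      simp only [e, norm_mul, Complex.norm_conj, hz1, one_mul]
    rw [Real.circleAverage_congr_sphere hcirc,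
      circleAverage_poissonKernel_mul_log_norm_of_ne_zero hc
        (f := fun z => 1 - (starRingEnd ℂ) ρ * z) (by fun_prop)]
    · refine Real.log_le_log (norm_pos_iff.2 (sub_ne_zero.2 hne)) ?_
      rw [← sq_le_sq₀ (norm_nonneg _) (norm_nonneg _), ← Complex.normSq_eq_norm_sq,
        ← Complex.normSq_eq_norm_sq]
      have h1 : ‖ρ‖ ^ 2 ≤ 1 := by nlinarith [norm_nonneg ρ]
      have h2 : ‖c‖ ^ 2 ≤ 1 := by nlinarith [norm_nonneg c]
      rw [← Complex.normSq_eq_norm_sq, Complex.normSq_apply] at h1 h2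
      simp only [Complex.normSq_apply, Complex.sub_re, Complex.sub_im, Complex.one_re,
        Complex.one_im, Complex.mul_re, Complex.mul_im, Complex.conj_re, Complex.conj_im]
      nlinarith [mul_nonneg (sub_nonneg.2 h1) (sub_nonneg.2 h2)]
    · intro z hz h0
      have h1 : ‖(starRingEnd ℂ) ρ * z‖ = 1 := by
        rw [← sub_eq_zero.1 h0, norm_one]
      rw [norm_mul, Complex.norm_conj] at h1
      nlinarith [norm_nonneg ρ, norm_nonneg z]
  · have := circleAverage_re_herglotzRieszKernel_mul_log (w := c) (ρ := ρ) (c := 0) (R := 1)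
      (by simpa using h) (by simpa using hc)
    rw [← poissonKernel_eq_re_herglotzRieszKernel] at this
    exact this.ge
  · refine (circleAverage_poissonKernel_mul_log_norm_of_ne_zero hc (f := fun z => z - ρ)
      (by fun_prop) fun z hz h0 => ?_).ge
    rw [sub_eq_zero.1 h0] at hz
    linarith

lemma continuousOn_poissonKernel {c : ℂ} (hc : ‖c‖ < 1) :
    ContinuousOn (poissonKernel 0 c) (Metric.sphere 0 |1|) := by
  rw [poissonKernel_eq_re_herglotzRieszKernel]
  exact Complex.continuous_re.comp_continuousOn
    (continuousOn_herglotzRieszKernel_sphere (by simpa using hc))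

lemma circleIntegrable_poissonKernel_mul {c : ℂ} (hc : ‖c‖ < 1) {f : ℂ → ℝ}
    (hf : CircleIntegrable f 0 1) :
    CircleIntegrable (fun z => poissonKernel 0 c z * f z) 0 1 :=
  hf.continuousOn_mul (continuousOn_poissonKernel hc)

lemma circleIntegrable_log_norm_eval (p : ℂ[X]) :
    CircleIntegrable (fun z => Real.log ‖p.eval z‖) 0 1 :=
  (analyticOnNhd_id.aeval_polynomial p).meromorphicOn.circleIntegrable_log_norm

lemma circleAverage_poissonKernel {c : ℂ} (hc : ‖c‖ < 1) :
    Real.circleAverage (poissonKernel 0 c) 0 1 = 1 := by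
  have h := InnerProductSpace.HarmonicOnNhd.circleAverage_poissonKernel_smul
    (f := fun _ : ℂ => (1 : ℝ)) (c := 0) (R := 1) (w := c)
    (fun z _ => InnerProductSpace.harmonicAt_const _) (by simpa using hc)
  rw [← h]
  congr 1
  ext z
  simp

lemma circleAverage_poissonKernel_mul_const {c : ℂ} (hc : ‖c‖ < 1) (b : ℝ) :
    Real.circleAverage (fun z => poissonKernel 0 c z * b) 0 1 = b := by
  have : (fun z => poissonKernel 0 c z * b) = fun z => b • poissonKernel 0 c z := by
    ext z; simp [mul_comm]
  rw [this, Real.circleAverage_fun_smul, circleAverage_poissonKernel hc, smul_eq_mul, mul_one]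

lemma circleAverage_poissonKernel_mul_log_norm_eval_mul {c : ℂ} {p q : ℂ[X]}
    (hp : p ≠ 0) (hq : q ≠ 0) (hc : ‖c‖ < 1) :
    Real.circleAverage (fun z => poissonKernel 0 c z * Real.log ‖(p * q).eval z‖) 0 1 =
      Real.circleAverage (fun z => poissonKernel 0 c z * Real.log ‖p.eval z‖) 0 1 +
      Real.circleAverage (fun z => poissonKernel 0 c z * Real.log ‖q.eval z‖) 0 1 := by
  rw [← Real.circleAverage_fun_add
    (circleIntegrable_poissonKernel_mul hc (circleIntegrable_log_norm_eval p))
    (circleIntegrable_poissonKernel_mul hc (circleIntegrable_log_norm_eval q))]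
  -- Additivity of the logarithm can fail at zeros, where `Real.log 0 = 0`; these are finitely many
  -- and do not affect the average.
  refine Real.circleAverage_congr_codiscreteWithin ?_ one_ne_zero
  have hfin : Set.Finite {z | (p * q).eval z = 0} := by
    refine Set.Finite.subset (p * q).roots.toFinset.finite_toSet fun z hz => ?_
    simpa [hp, hq] using hz
  refine Filter.mem_of_superset
    (Filter.codiscreteWithin_mono (Set.subset_univ _) hfin.compl_mem_codiscrete) fun z hz => ?_
  have hz : (p * q).eval z ≠ 0 := hz
  rw [eval_mul] at hz
  change poissonKernel 0 c z * Real.log ‖(p * q).eval z‖ = _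
  rw [eval_mul, norm_mul, Real.log_mul (norm_ne_zero_iff.2 (left_ne_zero_of_mul hz))
    (norm_ne_zero_iff.2 (right_ne_zero_of_mul hz)), mul_add]

/-- The **Poisson–Jensen inequality** for polynomials. -/
theorem log_norm_eval_le_circleAverage_poissonKernel {c : ℂ} (hc : ‖c‖ < 1) (p : ℂ[X])
    (hp : p.eval c ≠ 0) :
    Real.log ‖p.eval c‖ ≤
      Real.circleAverage (fun z => poissonKernel 0 c z * Real.log ‖p.eval z‖) 0 1 := by
  -- Induct on the multiset of roots, one linear factor at a time, the leading coefficient kept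
  -- arbitrary.
  suffices H : ∀ (s : Multiset ℂ) (a : ℂ), a ≠ 0 → c ∉ s →
      Real.log ‖(C a * (s.map (X - C ·)).prod).eval c‖ ≤ Real.circleAverage (fun z =>
        poissonKernel 0 c z * Real.log ‖(C a * (s.map (X - C ·)).prod).eval z‖) 0 1 by
    have h0 : p ≠ 0 := by rintro rfl; simp at hp
    have h := H p.roots p.leadingCoeff (leadingCoeff_ne_zero.2 h0)
      (fun h => hp (isRoot_of_mem_roots h))
    rwa [← (IsAlgClosed.splits p).eq_prod_roots] at h
  intro s
  induction s using Multiset.induction with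
  | empty =>
    intro a _ _
    simp only [Multiset.map_zero, Multiset.prod_zero, mul_one, eval_C]
    rw [circleAverage_poissonKernel_mul_const hc]
  | cons ρ s ih =>
    intro a ha hs
    rw [Multiset.mem_cons, not_or] at hs
    have hprod : (s.map (X - C ·)).prod ≠ (0 : ℂ[X]) :=
      (monic_multiset_prod_of_monic s _ fun i _ => monic_X_sub_C i).ne_zero
    have e : C a * ((ρ ::ₘ s).map (X - C ·)).prod =
        (X - C ρ) * (C a * (s.map (X - C ·)).prod) := by
      rw [Multiset.map_cons, Multiset.prod_cons]; ring
    rw [e, circleAverage_poissonKernel_mul_log_norm_eval_mul (X_sub_C_ne_zero ρ)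
      (mul_ne_zero (C_ne_zero.2 ha) hprod) hc, eval_mul, norm_mul, Real.log_mul]
    · refine add_le_add ?_ (ih a ha hs.2)
      simpa using log_norm_sub_le_circleAverage_poissonKernel hc hs.1
    · simpa [sub_eq_zero] using hs.1
    · rw [norm_ne_zero_iff, eval_mul, eval_C, eval_multiset_prod]
      refine mul_ne_zero ha ?_
      rw [Ne, Multiset.prod_eq_zero_iff]
      simpa [sub_eq_zero] using hs.2

lemma poissonKernel_nonneg {c z : ℂ} (hc : ‖c‖ < 1) (hz : ‖z‖ = 1) : 0 ≤ poissonKernel 0 c z := by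
  rw [poissonKernel_def]
  simp only [sub_zero, hz]
  refine div_nonneg ?_ (sq_nonneg _)
  nlinarith [norm_nonneg c]

/-- A lower bound for the integral of `log |p|` over an arc on which the Poisson kernel
based at `c` is at least `κ`. -/
lemma le_integral_log_norm_eval_of_le_poissonKernel {p : ℂ[X]} {c : ℂ} (hc : ‖c‖ < 1)
    {B κ a b δ : ℝ} (hB : 1 ≤ B) (hp : ∀ z, ‖z‖ = 1 → ‖p.eval z‖ ≤ B) (hκ : 0 < κ) (hδ : 0 < δ)
    (hpc : δ ≤ ‖p.eval c‖) (ha : 0 ≤ a) (hab : a ≤ b) (hb : b ≤ 2 * Real.pi)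
    (hK : ∀ θ ∈ Set.Icc a b, κ ≤ poissonKernel 0 c (circleMap 0 1 θ)) :
    -(2 * Real.pi / κ * (Real.log B - Real.log δ)) ≤
      ∫ θ in a..b, Real.log ‖p.eval (circleMap 0 1 θ)‖ := by
  have hB0 : 0 ≤ Real.log B := Real.log_nonneg hB
  have hpc0 : p.eval c ≠ 0 := norm_pos_iff.1 (hδ.trans_le hpc)
  have hcm : ∀ θ, ‖circleMap 0 1 θ‖ = 1 := fun θ => by simp
  -- This gap is nonnegative, so restricting to the arc and replacing the kernel by `κ` can only
  -- decrease its weighted integral.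
  set f : ℂ → ℝ := fun z => Real.log B - Real.log ‖p.eval z‖ with hf
  have hf0 : ∀ θ, 0 ≤ f (circleMap 0 1 θ) := fun θ => by
    rw [hf, sub_nonneg]
    rcases eq_or_lt_of_le (norm_nonneg (p.eval (circleMap 0 1 θ))) with h | h
    -- At a zero of `p` the logarithm takes the value 0, and `B ≥ 1` is what keeps the gap
    -- nonnegative.
    · simp only [← h, Real.log_zero]; exact hB0
    · exact Real.log_le_log h (hp _ (hcm θ))
  have hfi : CircleIntegrable f 0 1 :=
    (circleIntegrable_const (Real.log B) 0 1).sub (circleIntegrable_log_norm_eval p)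
  have hKf : CircleIntegrable (fun z => poissonKernel 0 c z * f z) 0 1 :=
    circleIntegrable_poissonKernel_mul hc hfi
  have havg : Real.circleAverage (fun z => poissonKernel 0 c z * f z) 0 1 ≤
      Real.log B - Real.log δ := by
    have e : (fun z => poissonKernel 0 c z * f z) = fun z =>
        poissonKernel 0 c z * Real.log B - poissonKernel 0 c z * Real.log ‖p.eval z‖ := by
      ext z; rw [hf]; ring
    rw [e, Real.circleAverage_fun_sub
      (circleIntegrable_poissonKernel_mul hc (circleIntegrable_const _ _ _))
      (circleIntegrable_poissonKernel_mul hc (circleIntegrable_log_norm_eval p)),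
      circleAverage_poissonKernel_mul_const hc]
    have := log_norm_eval_le_circleAverage_poissonKernel hc p hpc0
    have := Real.log_le_log hδ hpc
    linarith
  rw [Real.circleAverage_def, smul_eq_mul, inv_mul_le_iff₀ Real.two_pi_pos] at havg
  have hsub : Set.uIcc a b ⊆ Set.uIcc 0 (2 * Real.pi) := by
    rw [Set.uIcc_of_le hab, Set.uIcc_of_le Real.two_pi_pos.le]
    exact Set.Icc_subset_Icc ha hb
  have hKf' : IntervalIntegrable (fun θ => poissonKernel 0 c (circleMap 0 1 θ) *
      f (circleMap 0 1 θ)) MeasureTheory.volume 0 (2 * Real.pi) := hKf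
  have hfi' : IntervalIntegrable (fun θ => f (circleMap 0 1 θ)) MeasureTheory.volume a b :=
    IntervalIntegrable.mono_set hfi hsub
  have hmono : ∫ θ in a..b, κ * f (circleMap 0 1 θ) ≤
      ∫ θ in a..b, poissonKernel 0 c (circleMap 0 1 θ) * f (circleMap 0 1 θ) :=
    intervalIntegral.integral_mono_on hab (hfi'.const_mul κ) (hKf'.mono_set hsub)
      fun θ hθ => mul_le_mul_of_nonneg_right (hK θ hθ) (hf0 θ)
  have hext : ∫ θ in a..b, poissonKernel 0 c (circleMap 0 1 θ) * f (circleMap 0 1 θ) ≤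
      ∫ θ in 0..2 * Real.pi, poissonKernel 0 c (circleMap 0 1 θ) * f (circleMap 0 1 θ) :=
    intervalIntegral.integral_mono_interval ha hab hb (Filter.Eventually.of_forall fun θ =>
      mul_nonneg (poissonKernel_nonneg hc (hcm θ)) (hf0 θ)) hKf'
  rw [intervalIntegral.integral_const_mul] at hmono
  have hsplit : ∫ θ in a..b, f (circleMap 0 1 θ) =
      (b - a) * Real.log B - ∫ θ in a..b, Real.log ‖p.eval (circleMap 0 1 θ)‖ := by
    rw [hf]
    simp only
    rw [intervalIntegral.integral_sub intervalIntegrable_const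
      (IntervalIntegrable.mono_set (circleIntegrable_log_norm_eval p) hsub)]
    simp
  have h1 : κ * ∫ θ in a..b, f (circleMap 0 1 θ) ≤
      2 * Real.pi * (Real.log B - Real.log δ) := hmono.trans (hext.trans havg)
  rw [mul_comm, ← le_div_iff₀ hκ, hsplit] at h1
  have : 0 ≤ (b - a) * Real.log B := mul_nonneg (sub_nonneg.2 hab) hB0
  rw [div_mul_eq_mul_div]
  linarith

/-! ### Good and bad cells of the grid -/

lemma hasDerivAt_eval_circleMap (p : ℂ[X]) (θ : ℝ) :
    HasDerivAt (fun θ : ℝ => p.eval (circleMap 0 1 θ))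
      ((derivative p).eval (circleMap 0 1 θ) * (circleMap 0 1 θ * Complex.I)) θ :=
  (p.hasDerivAt (circleMap 0 1 θ)).comp θ (hasDerivAt_circleMap 0 1 θ)

/-- The fundamental theorem of calculus followed by Cauchy–Schwarz, the latter obtained by expanding
`∫ (|p'| - t)² ≥ 0` at `t = ε/(b - a)`. -/
lemma sq_div_le_integral_norm_sq_derivative (p : ℂ[X]) {a b θ ε : ℝ} (hab : a < b)
    (hθ : θ ∈ Set.Icc a b) (hε : 0 ≤ ε)
    (h : ε ≤ ‖p.eval (circleMap 0 1 θ) - p.eval (circleMap 0 1 a)‖) :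
    ε ^ 2 / (b - a) ≤ ∫ x in a..b, ‖(derivative p).eval (circleMap 0 1 x)‖ ^ 2 := by
  have hba : 0 < b - a := sub_pos.2 hab
  have hc : Continuous fun x : ℝ => (derivative p).eval (circleMap 0 1 x) := by fun_prop
  have hcd : Continuous fun x : ℝ =>
      (derivative p).eval (circleMap 0 1 x) * (circleMap 0 1 x * Complex.I) := by fun_prop
  have h1 : ε ≤ ∫ x in a..b, ‖(derivative p).eval (circleMap 0 1 x)‖ := by
    calc ε ≤ _ := h
      _ = ‖∫ x in a..θ, (derivative p).eval (circleMap 0 1 x) * (circleMap 0 1 x * Complex.I)‖ := by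
          rw [intervalIntegral.integral_eq_sub_of_hasDerivAt
            (fun x _ => hasDerivAt_eval_circleMap p x) (hcd.intervalIntegrable _ _)]
      _ ≤ ∫ x in a..θ,
            ‖(derivative p).eval (circleMap 0 1 x) * (circleMap 0 1 x * Complex.I)‖ :=
          intervalIntegral.norm_integral_le_integral_norm hθ.1
      _ = ∫ x in a..θ, ‖(derivative p).eval (circleMap 0 1 x)‖ := by simp
      _ ≤ _ := intervalIntegral.integral_mono_interval le_rfl hθ.1 hθ.2
          (Filter.Eventually.of_forall fun x => norm_nonneg _) (hc.norm.intervalIntegrable _ _)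
  set t := ε / (b - a) with ht
  have h2 : 0 ≤ ∫ x in a..b, (‖(derivative p).eval (circleMap 0 1 x)‖ - t) ^ 2 :=
    intervalIntegral.integral_nonneg hab.le fun x _ => sq_nonneg _
  have h3 : ∫ x in a..b, (‖(derivative p).eval (circleMap 0 1 x)‖ - t) ^ 2 =
      (∫ x in a..b, ‖(derivative p).eval (circleMap 0 1 x)‖ ^ 2) -
        2 * t * (∫ x in a..b, ‖(derivative p).eval (circleMap 0 1 x)‖) + (b - a) * t ^ 2 := by
    have e : (fun x => (‖(derivative p).eval (circleMap 0 1 x)‖ - t) ^ 2) = fun x =>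
        ‖(derivative p).eval (circleMap 0 1 x)‖ ^ 2 -
          2 * t * ‖(derivative p).eval (circleMap 0 1 x)‖ + t ^ 2 := by ext x; ring
    rw [e, intervalIntegral.integral_add, intervalIntegral.integral_sub,
      intervalIntegral.integral_const_mul, intervalIntegral.integral_const, smul_eq_mul]
    all_goals exact Continuous.intervalIntegrable (by fun_prop) _ _
  have h4 : 2 * t * ε ≤ 2 * t * (∫ x in a..b, ‖(derivative p).eval (circleMap 0 1 x)‖) := by
    gcongr
  have h5 : 2 * t * ε - (b - a) * t ^ 2 = ε ^ 2 / (b - a) := by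
    rw [ht]; field_simp; ring
  linarith

lemma norm_eval_gaussFresnel_le {n : ℕ} (hn : 0 < n) {z : ℂ} (hz : ‖z‖ = 1) :
    ‖(gaussFresnel n).eval z‖ ≤ Real.sqrt n := by
  have hs : (0 : ℝ) < Real.sqrt n := Real.sqrt_pos.2 (by exact_mod_cast hn)
  have h3 : Real.sqrt n * Real.sqrt n = n := Real.mul_self_sqrt (Nat.cast_nonneg n)
  rw [eval_gaussFresnel_eq_sum]
  calc _ ≤ ∑ j ∈ Finset.range n, (Real.sqrt n)⁻¹ := by
        refine norm_sum_le_of_le _ fun j _ => ?_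
        rw [norm_mul, norm_gaussCoeff, norm_pow, hz, one_pow, mul_one]
    _ = n * (Real.sqrt n)⁻¹ := by simp
    _ = Real.sqrt n := by rw [← h3]; field_simp; rw [Real.sqrt_sq hs.le]

lemma chirpRoot_zpow_eq_circleMap (n k : ℕ) :
    chirpRoot n ^ (2 * (k : ℤ)) = circleMap 0 1 (2 * Real.pi / n * k) := by
  rw [chirpRoot_zpow, circleMap]
  simp only [Complex.ofReal_one, one_mul, zero_add]
  congr 1
  push_cast
  ring

lemma le_poissonKernel_circleMap {r α θ : ℝ} (hr0 : 0 ≤ r) (hr1 : r < 1) :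
    (1 - r) / ((1 - r) + |θ - α|) ^ 2 ≤
      poissonKernel 0 (r * circleMap 0 1 α) (circleMap 0 1 θ) := by
  have hα : ‖circleMap 0 1 α‖ = 1 := by simp
  have hθ : ‖circleMap 0 1 θ‖ = 1 := by simp
  have hc : ‖(r : ℂ) * circleMap 0 1 α‖ = r := by
    rw [norm_mul, hα, mul_one, Complex.norm_real, Real.norm_of_nonneg hr0]
  have hlip : ‖circleMap 0 1 θ - circleMap 0 1 α‖ ≤ |θ - α| := by
    have := (lipschitzWith_circleMap 0 1).dist_le_mul θ α
    simpa [dist_eq_norm] using this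
  have hle : ‖circleMap 0 1 θ - r * circleMap 0 1 α‖ ≤ (1 - r) + |θ - α| := by
    have e : circleMap 0 1 θ - r * circleMap 0 1 α =
        (circleMap 0 1 θ - circleMap 0 1 α) + ((1 - r : ℝ) : ℂ) * circleMap 0 1 α := by
      push_cast; ring
    rw [e]
    refine (norm_add_le _ _).trans ?_
    rw [norm_mul, hα, Complex.norm_real, Real.norm_of_nonneg (by linarith)]
    linarith
  have hpos : 0 < ‖circleMap 0 1 θ - r * circleMap 0 1 α‖ := by
    have := norm_sub_norm_le (circleMap 0 1 θ) (r * circleMap 0 1 α)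
    rw [hc, hθ] at this
    linarith
  rw [poissonKernel_def]
  simp only [sub_zero, hc, hθ]
  have : 1 - r ≤ 1 ^ 2 - r ^ 2 := by nlinarith
  gcongr
  linarith

/-- Apply `log y ≥ 1 - 1/y` at `y = x²`; for `η ≤ 1/2`, `(1 - η)(1 + 2η) ≥ 1`. -/
lemma neg_le_log_of_one_sub_le_sq {x η : ℝ} (hx : 0 ≤ x) (hη : η ≤ 1 / 2)
    (h0 : 0 ≤ η) (h : 1 - η ≤ x ^ 2) : -η ≤ Real.log x := by
  have hx0 : 0 < x := by
    rcases hx.eq_or_lt with rfl | h'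
    · norm_num at h; linarith
    · exact h'
  have h1 : Real.log (x ^ 2) = 2 * Real.log x := by rw [Real.log_pow]; norm_num
  have h2 := Real.one_sub_inv_le_log_of_pos (x := x ^ 2) (by positivity)
  have h3 : (x ^ 2)⁻¹ ≤ 1 + 2 * η := by
    rw [inv_le_iff_one_le_mul₀ (by positivity)]
    nlinarith
  linarith

/-- Lower bound for the logarithmic integral of a Gauss–Fresnel polynomial over one cell of
the grid of `n`-th roots of unity. -/
lemma le_integral_log_gaussFresnel_cell {n : ℕ} (hn : 0 < n) (he : Even n) {k : ℕ} (hk : k < n)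
    {η : ℝ} (hη0 : 0 < η) (hη : η ≤ 1 / 2) :
    -(2 * Real.pi / n * η) - 1024 * Real.pi ^ 2 * ((2 + Real.log n) ^ 2 / (n * (n * η ^ 2))) *
        (2 * ∫ θ in (2 * Real.pi / n * k)..(2 * Real.pi / n * (k + 1 : ℕ)),
          ‖(derivative (autocorrelationPoly n)).eval (circleMap 0 1 θ)‖ ^ 2) ≤
      ∫ θ in (2 * Real.pi / n * k)..(2 * Real.pi / n * (k + 1 : ℕ)),
        Real.log ‖(gaussFresnel n).eval (circleMap 0 1 θ)‖ := by
  have hpi := Real.pi_pos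
  have hn1 : (1 : ℝ) ≤ n := by exact_mod_cast hn
  have hn' : (0 : ℝ) < n := by linarith
  have hlog : 0 ≤ Real.log n := Real.log_nonneg hn1
  set h := 2 * Real.pi / n with hh
  have hh0 : 0 < h := by positivity
  set a := h * k with ha
  set b := h * (k + 1 : ℕ) with hb
  have hab' : b - a = h := by rw [ha, hb]; push_cast; ring
  have hab : a < b := by linarith
  have ha0 : 0 ≤ a := by positivity
  have hb1 : b ≤ 2 * Real.pi := by
    have : ((k + 1 : ℕ) : ℝ) ≤ n := by exact_mod_cast hk
    calc b ≤ h * n := by rw [hb]; gcongr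
      _ = 2 * Real.pi := by rw [hh]; field_simp
  set I := ∫ θ in a..b, ‖(derivative (autocorrelationPoly n)).eval (circleMap 0 1 θ)‖ ^ 2 with hI
  have hI0 : 0 ≤ I := intervalIntegral.integral_nonneg hab.le fun x _ => by positivity
  have hint : IntervalIntegrable (fun θ => Real.log ‖(gaussFresnel n).eval (circleMap 0 1 θ)‖)
      MeasureTheory.volume a b := by
    refine (circleIntegrable_log_norm_eval (gaussFresnel n)).mono_set ?_
    rw [Set.uIcc_of_le hab.le, Set.uIcc_of_le Real.two_pi_pos.le]
    exact Set.Icc_subset_Icc ha0 hb1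
  have hgrid : ‖(gaussFresnel n).eval (circleMap 0 1 a)‖ = 1 := by
    rw [ha, ← chirpRoot_zpow_eq_circleMap]
    exact norm_eval_gaussFresnel_grid hn he k
  by_cases hgood : ∀ θ ∈ Set.Icc a b, 1 - η ≤ ‖(gaussFresnel n).eval (circleMap 0 1 θ)‖ ^ 2
  · have h1 : ∫ θ in a..b, -η ≤
        ∫ θ in a..b, Real.log ‖(gaussFresnel n).eval (circleMap 0 1 θ)‖ :=
      intervalIntegral.integral_mono_on hab.le intervalIntegrable_const hint fun θ hθ =>
        neg_le_log_of_one_sub_le_sq (norm_nonneg _) hη hη0.le (hgood θ hθ)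
    rw [intervalIntegral.integral_const, hab', smul_eq_mul] at h1
    have h2 : 0 ≤ 1024 * Real.pi ^ 2 * ((2 + Real.log n) ^ 2 / (n * (n * η ^ 2))) * (2 * I) := by
      positivity
    linarith
  · push Not at hgood
    obtain ⟨θ, hθ, hbad⟩ := hgood
    -- `Re A` vanishes at the grid point `a` and is below `-η/2` at `θ`.
    have hIlow : (η / 2) ^ 2 / h ≤ I := by
      rw [← hab']
      refine sq_div_le_integral_norm_sq_derivative _ hab hθ (by positivity) ?_
      have e1 := norm_sq_eval_gaussFresnel hn (z := circleMap 0 1 θ) (by simp)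
      have e2 := norm_sq_eval_gaussFresnel hn (z := circleMap 0 1 a) (by simp)
      rw [hgrid] at e2
      rw [e1] at hbad
      rw [norm_sub_rev]
      refine le_trans ?_ (Complex.re_le_norm _)
      rw [Complex.sub_re]
      linarith
    have hτpos : 0 < 2 + Real.log n := by linarith
    -- The largest `τ` for which the interior value is still guaranteed to be at least `1/2`.
    set τ := 1 / (2 * (2 + Real.log n)) with hτ
    have hτ0 : 0 < τ := by positivity
    have hτ1 : τ ≤ 1 / 2 := by
      rw [hτ, div_le_div_iff₀ (by positivity) two_pos]; linarith
    have hτ2 : τ * (2 + Real.log n) ≤ 1 / 2 := by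
      rw [hτ]; apply le_of_eq; field_simp
    set r := 1 - τ / n with hr
    have hτn : τ / n ≤ 1 := by rw [div_le_one hn']; linarith
    have hτn0 : 0 < τ / n := by positivity
    have hr0 : 0 ≤ r := by linarith
    have hr1 : r < 1 := by linarith
    have hpc := half_le_norm_eval_gaussFresnel hn he k hτ0.le hτ2 (by linarith)
    rw [chirpRoot_zpow_eq_circleMap, ← hr, ← hh, ← ha] at hpc
    have hc : ‖(r : ℂ) * circleMap 0 1 a‖ < 1 := by
      rw [norm_mul, Complex.norm_real, Real.norm_of_nonneg hr0]
      simpa using hr1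
    have hK : ∀ x ∈ Set.Icc a b,
        τ * n / 64 ≤ poissonKernel 0 (r * circleMap 0 1 a) (circleMap 0 1 x) := by
      intro x hx
      refine le_trans ?_ (le_poissonKernel_circleMap hr0 hr1)
      have e : 1 - r = τ / n := by rw [hr]; ring
      rw [e, abs_of_nonneg (by linarith [hx.1])]
      -- `τ + 2π ≤ 1/2 + 6.3 < 8`; this is the source of the 64 in the kernel bound.
      have h1 : τ / n + (x - a) ≤ 8 / n := by
        have : x - a ≤ h := by linarith [hx.2]
        calc τ / n + (x - a) ≤ τ / n + h := by linarith
          _ = (τ + 2 * Real.pi) / n := by rw [hh]; ring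
          _ ≤ 8 / n := by
            gcongr
            have := Real.pi_lt_d2
            linarith
      calc τ * n / 64 = τ / n / (8 / n) ^ 2 := by field_simp; norm_num
        _ ≤ _ := by
          have : 0 < τ / n + (x - a) := by linarith [hx.1]
          gcongr
    have hmain := le_integral_log_norm_eval_of_le_poissonKernel hc (B := Real.sqrt n)
      (κ := τ * n / 64) (Real.one_le_sqrt.2 hn1) (fun z hz => norm_eval_gaussFresnel_le hn hz)
      (by positivity) (by norm_num : (0 : ℝ) < 1 / 2) hpc ha0 hab.le hb1 hK
    refine le_trans ?_ hmain
    have hlog2 : Real.log (Real.sqrt n) - Real.log (1 / 2) ≤ 2 + Real.log n := by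
      rw [Real.log_sqrt hn'.le, one_div, Real.log_inv]
      have := Real.log_two_lt_d9
      linarith
    have hD : 2 * Real.pi / (τ * n / 64) * (Real.log (Real.sqrt n) - Real.log (1 / 2)) ≤
        256 * Real.pi * (2 + Real.log n) ^ 2 / n := by
      calc _ ≤ 2 * Real.pi / (τ * n / 64) * (2 + Real.log n) := by gcongr
        _ = _ := by rw [hτ]; field_simp; norm_num
    -- The loss on a bad cell is charged to its energy, which is at least `(η/2)²/h`. Both kinds of
    -- cell then obey one bound that can be summed without counting bad cells.
    have hI2 : 256 * Real.pi * (2 + Real.log n) ^ 2 / n ≤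
        1024 * Real.pi ^ 2 * ((2 + Real.log n) ^ 2 / (n * (n * η ^ 2))) * (2 * I) := by
      calc 256 * Real.pi * (2 + Real.log n) ^ 2 / n = 1024 * Real.pi ^ 2 *
            ((2 + Real.log n) ^ 2 / (n * (n * η ^ 2))) * (2 * ((η / 2) ^ 2 / h)) := by
            rw [hh]; field_simp; norm_num
        _ ≤ _ := by gcongr
    have : 0 ≤ h * η := by positivity
    linarith

/-- Summing the cell bounds, the `n` good-cell losses add up to `2πη` and the local energies to the
global energy of `A'`. -/
theorem le_logMahlerMeasure_gaussFresnel {n : ℕ} (hn : 0 < n) (he : Even n) {η : ℝ}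
    (hη0 : 0 < η) (hη : η ≤ 1 / 2) :
    -η - 16384 * Real.pi ^ 2 / η ^ 2 * ((2 + Real.log n) ^ 3 / Real.sqrt n) ≤
      (gaussFresnel n).logMahlerMeasure := by
  have hpi := Real.pi_pos
  have hn1 : (1 : ℝ) ≤ n := by exact_mod_cast hn
  have hn' : (0 : ℝ) < n := by linarith
  have hlog : 0 ≤ Real.log n := Real.log_nonneg hn1
  have hs : 0 < Real.sqrt n := Real.sqrt_pos.2 hn'
  set g : ℝ → ℝ := fun θ => Real.log ‖(gaussFresnel n).eval (circleMap 0 1 θ)‖ with hg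
  set u : ℝ → ℝ :=
    fun θ => ‖(derivative (autocorrelationPoly n)).eval (circleMap 0 1 θ)‖ ^ 2 with hu
  set p : ℕ → ℝ := fun k => 2 * Real.pi / n * k with hp
  have hp0 : p 0 = 0 := by simp [hp]
  have hpn : p n = 2 * Real.pi := by rw [hp]; field_simp
  have hmono : ∀ {i j : ℕ}, i ≤ j → p i ≤ p j := fun hij => by
    simp only [hp]; gcongr
  have hgi : ∀ k < n, IntervalIntegrable g MeasureTheory.volume (p k) (p (k + 1)) := fun k hk => by
    refine (circleIntegrable_log_norm_eval (gaussFresnel n)).mono_set ?_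
    rw [Set.uIcc_of_le (hmono k.le_succ), Set.uIcc_of_le Real.two_pi_pos.le, ← hpn]
    refine Set.Icc_subset_Icc ?_ (hmono hk)
    rw [← hp0]
    exact hmono k.zero_le
  have hui : ∀ k < n, IntervalIntegrable u MeasureTheory.volume (p k) (p (k + 1)) := fun k _ =>
    Continuous.intervalIntegrable (by fun_prop) _ _
  have hgsum := intervalIntegral.sum_integral_adjacent_intervals hgi
  have husum := intervalIntegral.sum_integral_adjacent_intervals hui
  rw [hp0, hpn] at hgsum husum
  have hV := circleAverage_norm_sq_derivative_autocorrelationPoly_le hn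
  rw [Real.circleAverage_def, smul_eq_mul, inv_mul_le_iff₀ Real.two_pi_pos] at hV
  set D := 1024 * Real.pi ^ 2 * ((2 + Real.log n) ^ 2 / (n * (n * η ^ 2))) with hD
  have hD0 : 0 ≤ D := by positivity
  have hcells : ∑ k ∈ Finset.range n,
      (-(2 * Real.pi / n * η) - D * (2 * ∫ θ in p k..p (k + 1), u θ)) ≤
      ∑ k ∈ Finset.range n, ∫ θ in p k..p (k + 1), g θ :=
    Finset.sum_le_sum fun k hk =>
      le_integral_log_gaussFresnel_cell hn he (Finset.mem_range.1 hk) hη0 hη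
  rw [hgsum, Finset.sum_sub_distrib, ← Finset.mul_sum, ← Finset.mul_sum, husum, Finset.sum_const,
    Finset.card_range, nsmul_eq_mul] at hcells
  have e1 : (n : ℝ) * -(2 * Real.pi / n * η) = 2 * Real.pi * -η := by field_simp
  rw [e1] at hcells
  rw [logMahlerMeasure_def, Real.circleAverage_def, smul_eq_mul, le_inv_mul_iff₀ Real.two_pi_pos]
  refine le_trans ?_ hcells
  have h1 : D * (2 * ∫ θ in 0..2 * Real.pi, u θ) ≤
      D * (2 * (2 * Real.pi * (8 * n ^ 2 * (1 + Real.log n) / Real.sqrt n))) := by gcongr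
  have h2 : D * (2 * (2 * Real.pi * (8 * n ^ 2 * (1 + Real.log n) / Real.sqrt n))) ≤
      D * (2 * (2 * Real.pi * (8 * n ^ 2 * (2 + Real.log n) / Real.sqrt n))) := by
    gcongr
    norm_num
  have h3 : D * (2 * (2 * Real.pi * (8 * n ^ 2 * (2 + Real.log n) / Real.sqrt n))) =
      2 * Real.pi * (16384 * Real.pi ^ 2 / η ^ 2 * ((2 + Real.log n) ^ 3 / Real.sqrt n)) := by
    rw [hD]; field_simp; norm_num
  linarith

/-! ### Passage to the limit and unimodular coefficients -/

lemma tendsto_two_add_log_pow_div_sqrt :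
    Filter.Tendsto (fun x : ℝ => (2 + Real.log x) ^ 3 / Real.sqrt x) Filter.atTop (nhds 0) := by
  -- The exponent `1/6` is chosen so that its cube is `√x`.
  have h1 : (fun x : ℝ => 2 + Real.log x) =o[Filter.atTop] fun x : ℝ => x ^ (1 / 6 : ℝ) := by
    refine Asymptotics.IsLittleO.add ?_ (isLittleO_log_rpow_atTop (by norm_num))
    exact Asymptotics.isLittleO_const_left.2 (Or.inr
      (Filter.tendsto_abs_atTop_atTop.comp (tendsto_rpow_atTop (by norm_num))))
  have h2 := (h1.pow (n := 3) (by norm_num)).tendsto_div_nhds_zero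
  refine h2.congr' ?_
  filter_upwards [Filter.eventually_ge_atTop 0] with x hx
  rw [Real.sqrt_eq_rpow, ← Real.rpow_natCast (x ^ (1 / 6 : ℝ)), ← Real.rpow_mul hx]
  norm_num

lemma coeff_gaussFresnel (n i : ℕ) :
    (gaussFresnel n).coeff i = if i < n then gaussCoeff n i else 0 := by
  simp only [gaussFresnel, coeff_C_mul, finsetSum_coeff, coeff_X_pow, mul_ite, mul_one, mul_zero,
    Finset.sum_ite_eq, Finset.mem_range]
  refine if_congr Iff.rfl ?_ rfl
  rw [gaussCoeff, chirpRoot, ← Complex.exp_int_mul]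
  congr 2
  push_cast
  ring

lemma gaussFresnel_ne_zero {n : ℕ} (hn : 0 < n) : gaussFresnel n ≠ 0 := by
  intro h
  have h1 := coeff_gaussFresnel n 0
  rw [if_pos hn, h, coeff_zero] at h1
  have h2 := norm_gaussCoeff n 0
  rw [← h1, norm_zero] at h2
  have : 0 < Real.sqrt n := Real.sqrt_pos.2 (by exact_mod_cast hn)
  exact (inv_pos.2 this).ne h2

lemma mahlerMeasure_gaussFresnel_le_one {n : ℕ} (hn : 0 < n) :
    (gaussFresnel n).mahlerMeasure ≤ 1 := by
  refine (mahlerMeasure_le_sqrt_sum_sq_norm_coeff _).trans (Real.sqrt_le_one.2 ?_)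
  rw [← sum_norm_sq_gaussCoeff hn]
  calc _ ≤ ∑ i ∈ Finset.range n, ‖(gaussFresnel n).coeff i‖ ^ 2 := by
        refine Finset.sum_le_sum_of_subset_of_nonneg (fun i hi => ?_) fun _ _ _ => by positivity
        rw [mem_support_iff, coeff_gaussFresnel] at hi
        by_contra h
        rw [Finset.mem_range] at h
        exact hi (if_neg h)
    _ = _ := Finset.sum_congr rfl fun i hi => by
        rw [coeff_gaussFresnel, if_pos (Finset.mem_range.1 hi)]

/-- The Mahler measures of the Gauss–Fresnel polynomials of even index tend to `1`. -/
theorem tendsto_mahlerMeasure_gaussFresnel_even :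
    Filter.Tendsto (fun k : ℕ => (gaussFresnel (2 * (k + 1))).mahlerMeasure) Filter.atTop
      (nhds 1) := by
  have hlim : Filter.Tendsto (fun k : ℕ => (2 + Real.log ((2 * (k + 1) : ℕ) : ℝ)) ^ 3 /
      Real.sqrt ((2 * (k + 1) : ℕ) : ℝ)) Filter.atTop (nhds 0) := by
    refine tendsto_two_add_log_pow_div_sqrt.comp (tendsto_natCast_atTop_atTop.comp ?_)
    exact Filter.tendsto_atTop_mono (fun k => by simp; omega) Filter.tendsto_id
  rw [Metric.tendsto_atTop']
  intro ε hε
  -- Eventually the error term is below `η`, so `log M ≥ -2η` and `M ≥ 1 - 2η ≥ 1 - ε/2`.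
  set η := min (ε / 4) (1 / 2) with hη
  have hη0 : 0 < η := by positivity
  have h0 := hlim.const_mul (16384 * Real.pi ^ 2 / η ^ 2)
  rw [mul_zero] at h0
  obtain ⟨K, hK⟩ := Filter.eventually_atTop.1 (h0.eventually (gt_mem_nhds hη0))
  refine ⟨K, fun k hk => ?_⟩
  have hn : 0 < 2 * (k + 1) := by omega
  have h1 := le_logMahlerMeasure_gaussFresnel hn (even_two_mul _) hη0 (min_le_right _ _)
  have h2 := hK k hk.le
  have h3 := mahlerMeasure_gaussFresnel_le_one hn
  have h4 : 1 - 2 * η ≤ (gaussFresnel (2 * (k + 1))).mahlerMeasure := by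
    rw [mahlerMeasure, if_pos (gaussFresnel_ne_zero hn)]
    refine le_trans ?_ (Real.add_one_le_exp _)
    linarith
  have h5 : η ≤ ε / 4 := min_le_left _ _
  rw [Real.dist_eq, abs_lt]
  constructor <;> linarith

lemma natDegree_C_mul_gaussFresnel {n : ℕ} (hn : 0 < n) {a : ℂ} (ha : a ≠ 0) :
    (C a * gaussFresnel n).natDegree = n - 1 := by
  rw [natDegree_C_mul ha]
  refine natDegree_eq_of_le_of_coeff_ne_zero ?_ ?_
  · rw [natDegree_le_iff_coeff_eq_zero]
    intro i hi
    rw [coeff_gaussFresnel, if_neg (by omega)]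
  · rw [coeff_gaussFresnel, if_pos (by omega), ← norm_ne_zero_iff, norm_gaussCoeff]
    have : 0 < Real.sqrt n := Real.sqrt_pos.2 (by exact_mod_cast hn)
    positivity

theorem mainTheorem2 :
    (∃ φ : ℕ → ℕ, StrictMono φ ∧ (∀ k, 1 ≤ φ k) ∧
      Filter.Tendsto (fun k => (gaussFresnel (φ k)).mahlerMeasure) Filter.atTop (nhds 1)) ∧
    (∃ q : ℕ → Polynomial ℂ, StrictMono (fun k => (q k).natDegree) ∧
      (∀ k, ∀ j ≤ (q k).natDegree, ‖(q k).coeff j‖ = 1) ∧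
      Filter.Tendsto
        (fun k => (q k).mahlerMeasure / Real.sqrt (((q k).natDegree : ℝ) + 1))
        Filter.atTop (nhds 1)) := by
  refine ⟨⟨fun k => 2 * (k + 1), fun a b hab => by dsimp only; omega, fun k => by dsimp only; omega,
    tendsto_mahlerMeasure_gaussFresnel_even⟩,
    fun k => C (Real.sqrt (2 * (k + 1) : ℕ) : ℂ) * gaussFresnel (2 * (k + 1)), ?_⟩
  have hs : ∀ k : ℕ, 0 < Real.sqrt (2 * (k + 1) : ℕ) := fun k =>
    Real.sqrt_pos.2 (by exact_mod_cast (by omega : 0 < 2 * (k + 1)))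
  have hdeg : ∀ k : ℕ, (C (Real.sqrt (2 * (k + 1) : ℕ) : ℂ) *
      gaussFresnel (2 * (k + 1))).natDegree = 2 * (k + 1) - 1 := fun k =>
    natDegree_C_mul_gaussFresnel (by omega) (Complex.ofReal_ne_zero.2 (hs k).ne')
  simp only [hdeg]
  refine ⟨fun a b hab => by simp only; omega, fun k j hj => ?_,
    tendsto_mahlerMeasure_gaussFresnel_even.congr fun k => ?_⟩
  · rw [coeff_C_mul, coeff_gaussFresnel, if_pos (by omega), norm_mul, norm_gaussCoeff,
      Complex.norm_real, Real.norm_of_nonneg (hs k).le, mul_inv_cancel₀ (hs k).ne']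
  -- The degree is `n - 1`, so the normalisation `√(deg + 1)` is exactly the scaling factor `√n`.
  · have e : (((2 * (k + 1) - 1 : ℕ) : ℝ) + 1) = ((2 * (k + 1) : ℕ) : ℝ) := by
      rw [← Nat.cast_succ]; congr 1
    rw [e, mahlerMeasure_mul, mahlerMeasure_const, Complex.norm_real,
      Real.norm_of_nonneg (hs k).le, mul_div_cancel_left₀ _ (hs k).ne']
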